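/- For two nondecreasing words $u,v$ with letters in $[1,k]$ and $0\le |u|-|v|\le 1$, the faro shuffle of $u$ and $v$ is the word $u_1v_1u_2v_2u_3v_3\cdots$ of length $|u|+|v|$; the words so obtained are the $k$-ary faro words. A faro permutation of length $n\ge 0$ is an $n$-ary faro word of length $n$ that contains every letter of $[1,n]$ exactly once. An occurrence of a pattern $p=p_1\cdots p_m$ in a word $w$ is a position $i$ such that the factor $w_iw_{i+1}\cdots w_{i+m-1}$ of consecutive letters is order-isomorphic to $p$. For a pattern $p$, let $K_p(x,y)$ be the bivariate formal power series in which the coefficient of $x^ny^k$ is the number of faro permutations of length $n$ with exactly $k$ occurrences of $p$. Then, where $\sqrt{\,\cdot\,}$ denotes the square root with constant term $1$ of a formal power series with constant term $1$, and quotients are taken in the fraction field of $\mathbb{Q}[[x,y]]$, \begin{align*} K_{21}(x,y) &= \frac{2}{1-2x+\sqrt{1-4x^2y}},\\ K_{12}(x,y) &= \frac{1+y+2xy-2xy^2+(y-1)\sqrt{1-4x^2y}}{y\left(1-2xy+\sqrt{1-4x^2y}\right)},\\ K_{132}(x,y) &= \frac{1+y+(y-1)\sqrt{1-4x^2y}}{y\left(1-2x+\sqrt{1-4x^2y}\right)},\\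 K_{213}(x,y) &= K_{132}(x,y),\\ K_{123}(x,y) &= \frac{2+3x-3xy+2x^2-2x^2y-x(1-y)\sqrt{1-4x^2}}{1-2xy+\sqrt{1-4x^2}}. \end{align*} -/

import Mathlib

namespace Faro

/-! ### Faro words and faro permutations. Words are lists of positive integers. -/

/-- The word `u₁ v₁ u₂ v₂ u₃ v₃ …` obtained by interlacing the letters of `u` and `v`. -/
def faroShuffle : List ℕ → List ℕ → List ℕ
  | [], v => v
  | a :: u, [] => a :: u
  | a :: u, b :: v => a :: b :: faroShuffle u v

/-- `w` is a `k`-ary word: all of its letters belong to `[1, k]`. -/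
def IsKAry (k : ℕ) (w : List ℕ) : Prop := ∀ a ∈ w, 1 ≤ a ∧ a ≤ k

/-- A `k`-ary faro word is the faro shuffle of two nondecreasing `k`-ary words `u`, `v` with
`0 ≤ |u| - |v| ≤ 1`. -/
def IsFaroWord (k : ℕ) (w : List ℕ) : Prop :=
  ∃ u v : List ℕ, IsKAry k u ∧ IsKAry k v ∧ u.Pairwise (· ≤ ·) ∧ v.Pairwise (· ≤ ·) ∧
    v.length ≤ u.length ∧ u.length ≤ v.length + 1 ∧ w = faroShuffle u v

/-- A faro permutation of length `n` is an `n`-ary faro word of length `n` that contains every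
letter of `[1, n]` exactly once. -/
def IsFaroPerm (n : ℕ) (w : List ℕ) : Prop :=
  IsFaroWord n w ∧ w.length = n ∧ ∀ a : ℕ, 1 ≤ a → a ≤ n → w.count a = 1

/-! ### Consecutive patterns -/

/-- The words `u` and `v` are order-isomorphic. -/
def OrderIsomorphic (u v : List ℕ) : Prop :=
  u.length = v.length ∧ ∀ i < u.length, ∀ j < u.length,
    (u.getD i 0 < u.getD j 0 ↔ v.getD i 0 < v.getD j 0)

instance (u v : List ℕ) : Decidable (OrderIsomorphic u v) := by
  unfold OrderIsomorphic; infer_instance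

/-- The number of occurrences in `w` of the consecutive pattern `p`: the number of positions at
which a factor of `w` that is order-isomorphic to `p` starts. -/
def occ (p w : List ℕ) : ℕ :=
  ((Finset.range (w.length + 1 - p.length)).filter
    (fun i => OrderIsomorphic ((w.drop i).take p.length) p)).card

/-- The set of faro permutations of length `n` with exactly `k` occurrences of `p`. -/
def faroPermsWith (p : List ℕ) (n k : ℕ) : Set (List ℕ) :=
  {w | IsFaroPerm n w ∧ occ p w = k}

/-- The sets being counted are finite. -/
theorem faroPermsWith_finite (p : List ℕ) (n k : ℕ) : (faroPermsWith p n k).Finite := by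
  refine (List.finite_length_eq (Fin (n + 1)) n).image (List.map Fin.val) |>.subset ?_
  rintro w ⟨⟨⟨u, v, hu, hv, -, -, -, -, hw⟩, hl, -⟩, -⟩
  have key : ∀ u v : List ℕ, IsKAry n u → IsKAry n v → IsKAry n (faroShuffle u v) := by
    intro u v
    induction u, v using faroShuffle.induct with
    | case1 v => intro _ h; simpa [faroShuffle] using h
    | case2 a u => intro h _; simpa [faroShuffle] using h
    | case3 a u b v ih =>
      intro h1 h2
      simp only [IsKAry, faroShuffle, List.mem_cons, forall_eq_or_imp] at h1 h2 ⊢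
      exact ⟨h1.1, h2.1, ih h1.2 h2.2⟩
  have hk := hw ▸ key u v hu hv
  refine ⟨w.map (Fin.ofNat (n + 1)), by simpa using hl, ?_⟩
  rw [List.map_map]
  refine (List.map_congr_left fun a ha => ?_).trans (List.map_id w)
  have := (hk a ha).2
  simp only [Function.comp, Fin.val_ofNat, id]
  exact Nat.mod_eq_of_lt (by omega)

/-! ### Bivariate formal power series -/

/-- The ring `ℚ⟦x, y⟧`. -/
abbrev Series := MvPowerSeries (Fin 2) ℚ

/-- The variable `x`. -/
noncomputable def x : Series := MvPowerSeries.X 0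

/-- The variable `y`. -/
noncomputable def y : Series := MvPowerSeries.X 1

/-- The embedding of `ℚ⟦x, y⟧` into its field of fractions, in which quotients are taken. -/
noncomputable def toFrac : Series →+* FractionRing Series := algebraMap Series (FractionRing Series)

/-- The square root `∑ₙ (1/2 choose n) (f - 1)ⁿ` of a series `f` with constant term `1`. -/
noncomputable def sqrt (f : Series) : Series :=
  (PowerSeries.binomialSeries ℚ (1 / 2 : ℚ)).subst (f - 1)

theorem hasSubst_sub_one {f : Series} (hf : MvPowerSeries.constantCoeff f = 1) :
    PowerSeries.HasSubst (f - 1) :=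
  PowerSeries.HasSubst.of_constantCoeff_zero (by simp [hf])

/-- `sqrt f` is a square root of `f`. -/
theorem sqrt_sq {f : Series} (hf : MvPowerSeries.constantCoeff f = 1) : sqrt f ^ 2 = f := by
  have h := hasSubst_sub_one hf
  have e : PowerSeries.binomialSeries ℚ (1 / 2 : ℚ) * PowerSeries.binomialSeries ℚ (1 / 2 : ℚ)
      = 1 + PowerSeries.X := by
    rw [← PowerSeries.binomialSeries_add]
    have := PowerSeries.binomialSeries_nat (R := ℚ) (A := ℚ) 1
    norm_num at this ⊢
    exact this
  rw [sqrt, sq, ← PowerSeries.subst_mul h, e, PowerSeries.subst_add h, PowerSeries.subst_X h,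
    ← PowerSeries.coe_substAlgHom h, map_one]
  ring

/-- `sqrt f` is the square root of `f` with constant term `1`. -/
theorem constantCoeff_sqrt {f : Series} (hf : MvPowerSeries.constantCoeff f = 1) :
    MvPowerSeries.constantCoeff (sqrt f) = 1 := by
  have h0 : MvPowerSeries.constantCoeff (f - 1) = 0 := by simp [hf]
  rw [sqrt, PowerSeries.constantCoeff_subst (hasSubst_sub_one hf), finsum_eq_single _ 0]
  · simp
  · intro d hd
    rw [map_pow, h0, zero_pow hd, smul_zero]

/-- The generating function `K_p`: the coefficient of `xⁿ yᵏ` is the number of faro permutations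
of length `n` with exactly `k` occurrences of the consecutive pattern `p`. -/
noncomputable def K (p : List ℕ) : Series :=
  fun m => ((faroPermsWith p (m 0) (m 1)).ncard : ℚ)

end Faro

open Faro

/-! Reading the letters 1, 2, …, n in order and recording whether each belongs to `u` (up) or `v`
(down) turns faro permutations into lattice paths ending at height |u| - |v|, which is 0 or 1
(`K_eq_gf`). Letters of `u` fill the even positions from the left and those of `v` the odd ones,
counting from 0. Each new letter is the largest so far, so it creates a descent exactly when the
position after it is already filled; this happens exactly for the steps that approach the strip {0,
1} from outside (`letter_succ_slot`, `sum_desc`).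

The other patterns reduce to descents. Since w_i < w_{i+2}, an occurrence of 132 or 213 is a descent
preceded or followed by another letter, so only the first or the last descent position is lost, and
this is governed by the first or the last step of the path. A window of three letters has one of the
patterns 123, 132, 213. In a closed path, steps outside the strip pair up as departures and
approaches, so ascents and 123 count steps between heights 0 and 1 as well (`length_eq_of_closed`).

Every statistic is thus an additive step weight. With E = (1 + √(1 - 4x²yᵇ))/2, the series by final
height are geometric of ratio x/E on each side of the strip (`halfLine`), and a linear system at
heights -1, 0, 1 remains (`closedGF`, `nearlyClosedGF`). -/

namespace Faro

/-! ### Generating functions of weighted sets -/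

/-- The generating function of a set `T` whose elements carry a weight in `ℕ²`. -/
noncomputable def gf {α : Type*} (s : α → Fin 2 →₀ ℕ) (T : Set α) : Series :=
  fun m => (({a | a ∈ T ∧ s a = m} : Set α).ncard : ℚ)

section gf

variable {α β : Type*}

theorem coeff_gf (s : α → Fin 2 →₀ ℕ) (T : Set α) (m : Fin 2 →₀ ℕ) :
    MvPowerSeries.coeff m (gf s T) = (({a | a ∈ T ∧ s a = m} : Set α).ncard : ℚ) := rfl

theorem gf_congr {s s' : α → Fin 2 →₀ ℕ} {T : Set α} (h : ∀ a ∈ T, s a = s' a) :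
    gf s T = gf s' T := by
  ext m
  rw [coeff_gf, coeff_gf]
  congr 2
  ext a
  exact and_congr_right fun ha => by rw [h a ha]

/-- Finiteness of the fibres is essential: `ncard` is 0 on infinite sets and would not be additive.
-/
theorem gf_union {s : α → Fin 2 →₀ ℕ} (hs : ∀ m, {a | s a = m}.Finite) {T U : Set α}
    (h : Disjoint T U) : gf s (T ∪ U) = gf s T + gf s U := by
  ext m
  rw [map_add, coeff_gf, coeff_gf, coeff_gf, ← Nat.cast_add, ← Set.ncard_union_eq
    (h.mono (fun a ha => ha.1) (fun a ha => ha.1)) ((hs m).subset fun a ha => ha.2)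
    ((hs m).subset fun a ha => ha.2)]
  congr 2
  ext a
  simp only [Set.mem_union, Set.mem_ofPred_eq]
  tauto

theorem gf_image {s : α → Fin 2 →₀ ℕ} {t : β → Fin 2 →₀ ℕ} {T : Set α} {f : α → β}
    (hf : Set.InjOn f T) (d : Fin 2 →₀ ℕ) (h : ∀ a ∈ T, t (f a) = d + s a) :
    gf t (f '' T) = MvPowerSeries.monomial d 1 * gf s T := by
  ext m
  rw [MvPowerSeries.coeff_monomial_mul, coeff_gf, coeff_gf]
  have e : {b | b ∈ f '' T ∧ t b = m} = f '' {a | a ∈ T ∧ d + s a = m} := by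
    ext b
    constructor
    · rintro ⟨⟨a, ha, rfl⟩, hb⟩
      exact ⟨a, ⟨ha, by rw [← h a ha, hb]⟩, rfl⟩
    · rintro ⟨a, ⟨ha, hb⟩, rfl⟩
      exact ⟨⟨a, ha, rfl⟩, by rw [h a ha, hb]⟩
  rw [e, (hf.mono fun a ha => ha.1).ncard_image, one_mul]
  split_ifs with hd
  · congr 2
    ext a
    refine and_congr_right fun _ => ?_
    constructor
    · rintro rfl; simp
    · intro h'; rw [h', add_tsub_cancel_of_le hd]
  · rw [Nat.cast_eq_zero]
    convert Set.ncard_empty α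
    ext a
    simp only [Set.mem_ofPred_eq, Set.mem_empty_iff_false, iff_false, not_and]
    rintro _ rfl
    exact hd (self_le_add_right d (s a))

theorem gf_singleton (s : α → Fin 2 →₀ ℕ) (a : α) :
    gf s {a} = MvPowerSeries.monomial (s a) 1 := by
  classical
  ext m
  rw [coeff_gf, MvPowerSeries.coeff_monomial]
  split_ifs with h
  · rw [show {b | b ∈ ({a} : Set α) ∧ s b = m} = {a} by ext b; simp; rintro rfl; exact h.symm]
    simp
  · rw [show {b | b ∈ ({a} : Set α) ∧ s b = m} = ∅ by
      ext b; simp; rintro rfl; exact fun h' => h h'.symm]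
    simp

theorem gf_empty (s : α → Fin 2 →₀ ℕ) : gf s ∅ = 0 := by
  ext m
  simp [coeff_gf]

end gf

/-! ### Monomials and power series in x and y -/

/-- The exponent vector of `xⁿ yᵏ`. -/
noncomputable def expo (n k : ℕ) : Fin 2 →₀ ℕ := Finsupp.single 0 n + Finsupp.single 1 k

theorem expo_eq_iff {n k : ℕ} {m : Fin 2 →₀ ℕ} : expo n k = m ↔ n = m 0 ∧ k = m 1 := by
  constructor
  · rintro rfl; simp [expo]
  · rintro ⟨rfl, rfl⟩; ext i; fin_cases i <;> simp [expo]

theorem expo_add (n k n' k' : ℕ) : expo n k + expo n' k' = expo (n + n') (k + k') := by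
  simp only [expo, Finsupp.single_add]; abel

theorem monomial_expo (n k : ℕ) :
    (MvPowerSeries.monomial (expo n k) 1 : Series) = x ^ n * y ^ k := by
  rw [expo, x, y, MvPowerSeries.X_pow_eq, MvPowerSeries.X_pow_eq, MvPowerSeries.monomial_mul_monomial,
    one_mul]

theorem y_ne_zero : y ≠ 0 := by
  intro h
  have := congrArg (MvPowerSeries.coeff (Finsupp.single 1 1)) h
  simp [y, MvPowerSeries.coeff_X] at this

theorem constantCoeff_x : MvPowerSeries.constantCoeff x = 0 := by simp [x]

theorem ne_zero_of_constantCoeff {f : Series} (h : MvPowerSeries.constantCoeff f ≠ 0) : f ≠ 0 := by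
  rintro rfl; simp at h

/-- A series divisible by every power of `x` vanishes. -/
theorem eq_zero_of_x_pow_dvd {f : Series} (h : ∀ n, x ^ n ∣ f) : f = 0 := by
  ext m
  exact (MvPowerSeries.X_pow_dvd_iff.1 (h (m 0 + 1))) m (Nat.lt_succ_self _)

/-- The sequences solving a recurrence of motions on a half-line are geometric. -/
theorem halfLine {E c : Series} (hE : MvPowerSeries.constantCoeff E ≠ 0)
    (hEc : E ^ 2 = E - x ^ 2 * c) {f : ℕ → Series}
    (hf : ∀ k, f (k + 1) = x * f k + x * c * f (k + 2)) : E * f 1 = x * f 0 := by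
  have hE0 := ne_zero_of_constantCoeff hE
  obtain ⟨C, hC⟩ : ∃ C, E * C = 1 := ⟨E⁻¹, MvPowerSeries.mul_inv_cancel E hE⟩
  -- `D` is the defect from the ratio x/E. The other root of the characteristic equation is removed
  -- by divisibility: D k is x times a multiple of D (k + 1), hence divisible by every power of x.
  let D : ℕ → Series := fun k => f (k + 1) - x * C * f k
  have hD : ∀ k, D k = x * (c * C * D (k + 1)) := by
    intro k
    apply mul_left_cancel₀ (pow_ne_zero 2 hE0)
    simp only [D]
    linear_combination f (k + 1) * hEc + E * hf k +
      (-x * E * f k - x * c * E * f (k + 2) + x ^ 2 * c * f (k + 1) * (E * C + 1)) * hC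
  have hdvd : ∀ n k, x ^ n ∣ D k := by
    intro n
    induction n with
    | zero => simp
    | succ n ih =>
      intro k
      obtain ⟨g, hg⟩ := ih (k + 1)
      exact ⟨c * C * g, by rw [hD k, hg]; ring⟩
  have h0 : D 0 = 0 := eq_zero_of_x_pow_dvd fun n => hdvd n 0
  simp only [D, zero_add] at h0
  linear_combination E * h0 + x * f 0 * hC


/-! ### Lattice paths

A path is a list of up-steps (`true`) and down-steps (`false`) starting at height `0`; the head of
the list is the last step. -/

/-- The final height of a path. -/
def height : List Bool → ℤ
  | [] => 0
  | true :: P => height P + 1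
  | false :: P => height P - 1

/-- The weight of a step starting at height `h`: `a` for a step between the heights `0` and `1`,
`b` for any other step that approaches these heights, and `0` for a step that moves away. -/
def stepCost (a b : ℕ) (c : Bool) (h : ℤ) : ℕ :=
  if c then (if h = 0 then a else if h < 0 then b else 0)
  else (if h = 1 then a else if 1 < h then b else 0)

/-- The total weight of a path: its first step has weight `p` or `q` when it goes up or down, and
the other steps have weight `stepCost a b`. -/
def stat (p q a b : ℕ) : List Bool → ℕ
  | [] => 0
  | [c] => if c then p else q
  | c :: c' :: P => stat p q a b (c' :: P) + stepCost a b c (height (c' :: P))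

theorem stat_cons (p q a b : ℕ) (c : Bool) {P : List Bool} (hP : P ≠ []) :
    stat p q a b (c :: P) = stat p q a b P + stepCost a b c (height P) := by
  cases P with
  | nil => exact absurd rfl hP
  | cons c' P => rfl

/-- The exponents of `x` and `y` attached to a path. -/
noncomputable def pathWeight (p q a b : ℕ) (P : List Bool) : Fin 2 →₀ ℕ :=
  expo P.length (stat p q a b P)

theorem pathWeight_finite (p q a b : ℕ) (m : Fin 2 →₀ ℕ) :
    {P | pathWeight p q a b P = m}.Finite :=
  (List.finite_length_eq Bool (m 0)).subset fun _ hP => (expo_eq_iff.1 hP).1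

/-- The generating function of the nonempty paths that end at height `h`. -/
noncomputable def pathGF (p q a b : ℕ) (h : ℤ) : Series :=
  gf (pathWeight p q a b) {P | P ≠ [] ∧ height P = h}

theorem gf_single_step (p q a b : ℕ) (c : Bool) (r : Prop) [Decidable r] :
    gf (pathWeight p q a b) {P | P = [c] ∧ r} =
      if r then x * y ^ (if c then p else q) else 0 := by
  split_ifs with h <;> simp only [h, and_true, and_false]
  all_goals first
    | exact gf_empty _
    | (refine (gf_singleton _ _).trans ?_
       simp_all [pathWeight, stat, monomial_expo])

theorem gf_cons (p q a b : ℕ) (c : Bool) (h : ℤ) :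
    gf (pathWeight p q a b) (List.cons c '' {P | P ≠ [] ∧ height P = h}) =
      x * y ^ stepCost a b c h * pathGF p q a b h := by
  rw [gf_image (s := pathWeight p q a b) (List.cons_injective.injOn)
    (expo 1 (stepCost a b c h)), monomial_expo, pow_one, pathGF]
  rintro P ⟨hP, rfl⟩
  rw [pathWeight, pathWeight, expo_add, stat_cons _ _ _ _ _ hP, List.length_cons, add_comm 1,
    add_comm (stepCost _ _ _ _)]

/-- Removal of the last step. Paths of length one stand apart because their weight is `p` or `q`
rather than a `stepCost`. -/
theorem pathGF_eq (p q a b : ℕ) (h : ℤ) :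
    pathGF p q a b h = (if h = 1 then x * y ^ p else 0) + (if h = -1 then x * y ^ q else 0)
      + x * y ^ stepCost a b true (h - 1) * pathGF p q a b (h - 1)
      + x * y ^ stepCost a b false (h + 1) * pathGF p q a b (h + 1) := by
  have e : {P | P ≠ [] ∧ height P = h} =
      {P | P = [true] ∧ h = 1} ∪ {P | P = [false] ∧ h = -1}
        ∪ List.cons true '' {P | P ≠ [] ∧ height P = h - 1}
        ∪ List.cons false '' {P | P ≠ [] ∧ height P = h + 1} := by
    ext P
    rcases P with _ | ⟨c, _ | ⟨c', P⟩⟩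
    · simp
    · cases c <;> simp [height, eq_comm]
    · cases c <;> simp [height, eq_sub_iff_add_eq, sub_eq_iff_eq_add]
  have hs := pathWeight_finite p q a b
  have h1 := gf_single_step p q a b true (h = 1)
  have h2 := gf_single_step p q a b false (h = -1)
  rw [pathGF, e, gf_union hs, gf_union hs, gf_union hs, gf_cons, gf_cons, h1, h2]
  · simp
  · rw [Set.disjoint_left]
    rintro P ⟨rfl, -⟩ ⟨h, -⟩
    simp at h
  · rw [Set.disjoint_left]
    rintro P (⟨rfl, -⟩ | ⟨rfl, -⟩) ⟨Q, ⟨hQ, -⟩, h⟩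
    · simp_all
    · simp_all
  · rw [Set.disjoint_left]
    rintro P ((⟨rfl, -⟩ | ⟨rfl, -⟩) | ⟨Q', -, rfl⟩) ⟨Q, ⟨hQ, -⟩, h⟩
    · simp_all
    · simp_all
    · simp at h

/-! ### Solution of the recurrence over the heights -/

section solution

variable {p q a b : ℕ} {E : Series}

/-- At heights at least 2 every arriving up-step is free and every arriving down-step costs `b`, so
the half-line recurrence applies with c = yᵇ. -/
theorem pathGF_two (hE : MvPowerSeries.constantCoeff E ≠ 0) (hEb : E ^ 2 = E - x ^ 2 * y ^ b) :
    E * pathGF p q a b 2 = x * pathGF p q a b 1 := by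
  have key : ∀ k : ℕ, pathGF p q a b (((k + 1 : ℕ) : ℤ) + 1) =
      x * pathGF p q a b ((k : ℤ) + 1) + x * y ^ b * pathGF p q a b (((k + 2 : ℕ) : ℤ) + 1) := by
    intro k
    have h := pathGF_eq p q a b ((k + 1 : ℕ) + 1)
    rw [if_neg (by omega), if_neg (by omega)] at h
    have h1 : stepCost a b true ((k + 1 : ℕ) + 1 - 1) = 0 := by
      simp only [stepCost, if_true]; rw [if_neg (by omega), if_neg (by omega)]
    have h2 : stepCost a b false ((k + 1 : ℕ) + 1 + 1) = b := by
      simp only [stepCost, Bool.false_eq_true, if_false]; rw [if_neg (by omega), if_pos (by omega)]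
    rw [h1, h2] at h
    have h3 : ((k + 1 : ℕ) : ℤ) + 1 - 1 = k + 1 := by push_cast; ring
    have h4 : ((k + 1 : ℕ) : ℤ) + 1 + 1 = (k + 2 : ℕ) + 1 := by push_cast; ring
    rw [h3, h4] at h
    rw [h]; ring
  have := halfLine hE hEb (f := fun k : ℕ => pathGF p q a b ((k : ℤ) + 1)) key
  norm_num at this
  exact this

theorem pathGF_neg_two (hE : MvPowerSeries.constantCoeff E ≠ 0)
    (hEb : E ^ 2 = E - x ^ 2 * y ^ b) :
    E * pathGF p q a b (-2) = x * pathGF p q a b (-1) := by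
  have key : ∀ k : ℕ, pathGF p q a b (-(((k + 1 : ℕ) : ℤ) + 1)) =
      x * pathGF p q a b (-((k : ℤ) + 1)) + x * y ^ b * pathGF p q a b (-(((k + 2 : ℕ) : ℤ) + 1)) := by
    intro k
    have h := pathGF_eq p q a b (-((k + 1 : ℕ) + 1))
    rw [if_neg (by omega), if_neg (by omega)] at h
    have h1 : stepCost a b true (-((k + 1 : ℕ) + 1) - 1) = b := by
      simp only [stepCost, if_true]; rw [if_neg (by omega), if_pos (by omega)]
    have h2 : stepCost a b false (-((k + 1 : ℕ) + 1) + 1) = 0 := by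
      simp only [stepCost, Bool.false_eq_true, if_false]; rw [if_neg (by omega), if_neg (by omega)]
    rw [h1, h2] at h
    have h3 : -(((k + 1 : ℕ) : ℤ) + 1) + 1 = -(k + 1) := by push_cast; ring
    have h4 : -(((k + 1 : ℕ) : ℤ) + 1) - 1 = -((k + 2 : ℕ) + 1) := by push_cast; ring
    rw [h3, h4] at h
    rw [h]; ring
  have := halfLine hE hEb (f := fun k : ℕ => pathGF p q a b (-((k : ℤ) + 1))) key
  norm_num at this
  exact this

theorem pathGF_one (hE : MvPowerSeries.constantCoeff E ≠ 0) (hEb : E ^ 2 = E - x ^ 2 * y ^ b) :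
    E * pathGF p q a b 1 = x * y ^ p + x * y ^ a * pathGF p q a b 0 := by
  have h := pathGF_eq p q a b 1
  have h2 := pathGF_two (p := p) (q := q) (a := a) hE hEb
  norm_num [stepCost] at h
  apply mul_left_cancel₀ (ne_zero_of_constantCoeff hE)
  linear_combination E * h + x * y ^ b * h2 + pathGF p q a b 1 * hEb

theorem pathGF_neg_one (hE : MvPowerSeries.constantCoeff E ≠ 0)
    (hEb : E ^ 2 = E - x ^ 2 * y ^ b) :
    E * pathGF p q a b (-1) = x * y ^ q + x * pathGF p q a b 0 := by
  have h := pathGF_eq p q a b (-1)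
  have h2 := pathGF_neg_two (p := p) (q := q) (a := a) hE hEb
  norm_num [stepCost] at h
  apply mul_left_cancel₀ (ne_zero_of_constantCoeff hE)
  linear_combination E * h + x * y ^ b * h2 + pathGF p q a b (-1) * hEb

theorem pathGF_zero (p q a b : ℕ) : pathGF p q a b 0 =
    x * y ^ b * pathGF p q a b (-1) + x * y ^ a * pathGF p q a b 1 := by
  have h := pathGF_eq p q a b 0
  norm_num [stepCost] at h
  exact h

/-- The nonempty paths that end at height `0` or `1`. -/
theorem closedGF (hE : MvPowerSeries.constantCoeff E ≠ 0) (hEb : E ^ 2 = E - x ^ 2 * y ^ b) :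
    (E - x * y ^ a) * (pathGF p q a b 0 + pathGF p q a b 1) = x * y ^ p + y ^ q * (1 - E) := by
  have h0 := pathGF_zero p q a b
  have h1 := pathGF_one (p := p) (q := q) (a := a) hE hEb
  have h2 := pathGF_neg_one (p := p) (q := q) (a := a) hE hEb
  -- Eliminating height -1 produces x²yᵇ = E(1 - E), after which a common factor E cancels.
  apply mul_left_cancel₀ (ne_zero_of_constantCoeff hE)
  linear_combination E * h0 + E * h1 + x * y ^ b * h2 + (y ^ q) * hEb
    + pathGF p q a b 0 * hEb

/-- The nonempty paths that end at height `-1`, `0`, `1` or `2`. -/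
theorem nearlyClosedGF (hE : MvPowerSeries.constantCoeff E ≠ 0)
    (hEb : E ^ 2 = E - x ^ 2 * y ^ b) :
    E * (pathGF p q a b (-1) + pathGF p q a b 0 + pathGF p q a b 1 + pathGF p q a b 2) =
      (E + x) * (pathGF p q a b 0 + pathGF p q a b 1) + x * y ^ q := by
  linear_combination pathGF_two (p := p) (q := q) (a := a) hE hEb +
    pathGF_neg_one (p := p) (q := q) (a := a) hE hEb

end solution


/-! ### Faro shuffles -/

theorem faroShuffle_perm (u v : List ℕ) : (faroShuffle u v).Perm (u ++ v) := by
  induction u, v using faroShuffle.induct with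
  | case1 v => simp [faroShuffle]
  | case2 a u => simp [faroShuffle]
  | case3 a u b v ih =>
    rw [faroShuffle, List.cons_append]
    exact ((ih.cons b).trans List.perm_middle.symm).cons a

theorem getD_faroShuffle (u v : List ℕ) (h1 : v.length ≤ u.length) (h2 : u.length ≤ v.length + 1)
    (i : ℕ) : (faroShuffle u v).getD i 0 =
      if i % 2 = 0 then u.getD (i / 2) 0 else v.getD (i / 2) 0 := by
  induction u, v using faroShuffle.induct generalizing i with
  | case1 v => simp at h1; simp [faroShuffle, h1]
  | case2 a u =>
    simp at h2
    subst h2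
    rcases i with _ | _ | i
    · simp [faroShuffle]
    · simp [faroShuffle]
    · have h1 : (i + 1 + 1) / 2 = i / 2 + 1 := by omega
      simp [faroShuffle, h1]
  | case3 a u b v ih =>
    rcases i with _ | _ | i
    · simp [faroShuffle]
    · simp [faroShuffle]
    · simp only [List.length_cons] at h1 h2
      have := ih (by omega) (by omega) i
      have h3 : (i + 1 + 1) / 2 = i / 2 + 1 := by omega
      have h4 : (i + 1 + 1) % 2 = i % 2 := by omega
      simp only [faroShuffle, List.getD_cons_succ, this, h3, h4]

/-! ### The faro permutation of a path -/

/-- The first hand of cards: the times of the up-steps. -/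
def ups : List Bool → List ℕ
  | [] => []
  | c :: P => if c then ups P ++ [P.length + 1] else ups P

/-- The second hand of cards: the times of the down-steps. -/
def downs : List Bool → List ℕ
  | [] => []
  | c :: P => if c then downs P else downs P ++ [P.length + 1]

/-- The shuffle of the two hands of cards determined by a path. -/
def word (P : List Bool) : List ℕ := faroShuffle (ups P) (downs P)

/-- The letter at position `i` of the word of a path, and `0` if this position is vacant. -/
def letter (P : List Bool) (i : ℕ) : ℕ :=
  if i % 2 = 0 then (ups P).getD (i / 2) 0 else (downs P).getD (i / 2) 0

/-- The position of the letter that is added to the word of `P` by a further step. -/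
def slot (c : Bool) (P : List Bool) : ℕ :=
  if c then 2 * (ups P).length else 2 * (downs P).length + 1

theorem length_ups_add (P : List Bool) : (ups P).length + (downs P).length = P.length := by
  induction P with
  | nil => rfl
  | cons c P ih => cases c <;> simp [ups, downs] <;> omega

theorem length_ups_sub (P : List Bool) :
    ((ups P).length : ℤ) - (downs P).length = height P := by
  induction P with
  | nil => rfl
  | cons c P ih => cases c <;> simp [ups, downs, height] <;> omega

theorem ups_append_downs_perm (P : List Bool) :
    (ups P ++ downs P).Perm (List.range' 1 P.length) := by
  induction P with
  | nil => rfl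
  | cons c P ih =>
    have h := ih.append_right [P.length + 1]
    rw [List.length_cons, List.range'_concat, one_mul, add_comm 1]
    refine List.Perm.trans ?_ h
    cases c
    · simp [ups, downs]
    · simp only [ups, downs, if_true, List.append_assoc]
      exact List.Perm.append_left _ List.perm_append_comm

theorem mem_ups_or_downs {P : List Bool} {a : ℕ} (h : a ∈ ups P ∨ a ∈ downs P) :
    1 ≤ a ∧ a ≤ P.length := by
  have := (ups_append_downs_perm P).mem_iff.1 (List.mem_append.2 h)
  rw [List.mem_range'_1] at this
  omega

theorem ups_pairwise (P : List Bool) : (ups P).Pairwise (· ≤ ·) := by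
  induction P with
  | nil => simp [ups]
  | cons c P ih =>
    cases c
    · simpa [ups] using ih
    · simp only [ups, if_true, List.pairwise_append, List.pairwise_singleton, true_and]
      refine ⟨ih, fun a ha b hb => ?_⟩
      have := mem_ups_or_downs (Or.inl ha)
      rw [List.mem_singleton.1 hb]; omega

theorem downs_pairwise (P : List Bool) : (downs P).Pairwise (· ≤ ·) := by
  induction P with
  | nil => simp [downs]
  | cons c P ih =>
    cases c
    · simp only [downs, Bool.false_eq_true, if_false, List.pairwise_append,
        List.pairwise_singleton, true_and]
      refine ⟨ih, fun a ha b hb => ?_⟩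
      have := mem_ups_or_downs (Or.inr ha)
      rw [List.mem_singleton.1 hb]; omega
    · simpa [downs] using ih

theorem ups_injective {P Q : List Bool} (hl : P.length = Q.length) (h : ups P = ups Q) :
    P = Q := by
  induction P generalizing Q with
  | nil => exact (List.length_eq_zero_iff.1 hl.symm).symm
  | cons c P ih =>
    rcases Q with _ | ⟨d, Q⟩
    · simp at hl
    simp only [List.length_cons, add_left_inj] at hl
    have hP : P.length + 1 ∉ ups P := fun h => by
      have := mem_ups_or_downs (Or.inl h); omega
    have hQ : Q.length + 1 ∉ ups Q := fun h => by
      have := mem_ups_or_downs (Or.inl h); omega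
    cases c <;> cases d <;> simp only [ups, if_true, Bool.false_eq_true, if_false] at h
    · rw [ih hl h]
    · exact absurd (by rw [hl, h]; simp) hP
    · exact absurd (by rw [← hl, ← h]; simp) hQ
    · rw [ih hl (by rw [hl] at h; exact List.append_cancel_right h)]

theorem exists_append_of_max {n : ℕ} {u : List ℕ} (hu : u.Pairwise (· ≤ ·)) (hn : n ∈ u)
    (h : ∀ a ∈ u, a ≤ n) : ∃ u', u = u' ++ [n] := by
  rcases List.eq_nil_or_concat u with rfl | ⟨u', z, rfl⟩
  · simp at hn
  · refine ⟨u', ?_⟩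
    rw [List.concat_eq_append] at *
    have h1 := h z (by simp)
    rcases List.mem_append.1 hn with h2 | h2
    · have := (List.pairwise_append.1 hu).2.2 n h2 z (by simp)
      rw [le_antisymm h1 this]
    · rw [List.mem_singleton.1 h2]

/-- The largest letter ends one of the two nondecreasing words; it dictates the last step, and
induction applies to the rest. -/
theorem exists_path (n : ℕ) (u v : List ℕ) (hu : u.Pairwise (· ≤ ·)) (hv : v.Pairwise (· ≤ ·))
    (h : (u ++ v).Perm (List.range' 1 n)) :
    ∃ P : List Bool, P.length = n ∧ ups P = u ∧ downs P = v := by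
  induction n generalizing u v with
  | zero =>
    simp at h
    exact ⟨[], rfl, h.1.symm, h.2.symm⟩
  | succ n ih =>
    have hmem : ∀ a, a ∈ u ∨ a ∈ v ↔ 1 ≤ a ∧ a ≤ n + 1 := by
      intro a
      rw [← List.mem_append, h.mem_iff, List.mem_range'_1]; omega
    rw [List.range'_concat, one_mul, add_comm 1] at h
    rcases (hmem (n + 1)).2 (by omega) with hn | hn
    · obtain ⟨u', rfl⟩ := exists_append_of_max hu hn fun a ha => ((hmem a).1 (Or.inl ha)).2
      have h' : (u' ++ v).Perm (List.range' 1 n) := by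
        rw [← List.perm_append_right_iff [n + 1]]
        refine List.Perm.trans ?_ h
        simp only [List.append_assoc]
        exact List.Perm.append_left _ List.perm_append_comm
      obtain ⟨P, hP, h1, h2⟩ := ih u' v (List.pairwise_append.1 hu).1 hv h'
      exact ⟨true :: P, by simp [hP], by simp [ups, h1, hP], by simp [downs, h2]⟩
    · obtain ⟨v', rfl⟩ := exists_append_of_max hv hn fun a ha => ((hmem a).1 (Or.inr ha)).2
      have h' : (u ++ v').Perm (List.range' 1 n) := by
        rw [← List.perm_append_right_iff [n + 1]]
        simpa using h
      obtain ⟨P, hP, h1, h2⟩ := ih u v' hu (List.pairwise_append.1 hv).1 h'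
      exact ⟨false :: P, by simp [hP], by simp [ups, h1], by simp [downs, h2, hP]⟩

/-- The path ends at height `0` or `1`. -/
def IsClosed (P : List Bool) : Prop := height P = 0 ∨ height P = 1

theorem IsClosed.length_le {P : List Bool} (h : IsClosed P) :
    (downs P).length ≤ (ups P).length ∧ (ups P).length ≤ (downs P).length + 1 := by
  have := length_ups_sub P
  rcases h with h | h <;> omega

theorem word_perm (P : List Bool) : (word P).Perm (List.range' 1 P.length) :=
  (faroShuffle_perm _ _).trans (ups_append_downs_perm P)

theorem length_word (P : List Bool) : (word P).length = P.length := by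
  rw [(word_perm P).length_eq, List.length_range']

theorem getD_word {P : List Bool} (h : IsClosed P) (i : ℕ) : (word P).getD i 0 = letter P i :=
  getD_faroShuffle _ _ h.length_le.1 h.length_le.2 i

theorem isFaroPerm_word {P : List Bool} (h : IsClosed P) : IsFaroPerm P.length (word P) := by
  refine ⟨⟨ups P, downs P, fun a ha => mem_ups_or_downs (Or.inl ha),
    fun a ha => mem_ups_or_downs (Or.inr ha), ups_pairwise P, downs_pairwise P, h.length_le.1,
    h.length_le.2, rfl⟩, length_word P, fun a h1 h2 => ?_⟩
  rw [(word_perm P).count_eq]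
  exact List.count_eq_one_of_mem List.nodup_range' (List.mem_range'_1.2 ⟨h1, by omega⟩)

theorem IsFaroPerm.exists_path {n : ℕ} {w : List ℕ} (h : IsFaroPerm n w) :
    ∃ P : List Bool, P.length = n ∧ IsClosed P ∧ word P = w := by
  obtain ⟨⟨u, v, hu, hv, hsu, hsv, h1, h2, rfl⟩, -, hc⟩ := h
  have hp : (u ++ v).Perm (List.range' 1 n) := by
    rw [List.perm_iff_count]
    intro a
    rw [← (faroShuffle_perm u v).count_eq]
    by_cases ha : 1 ≤ a ∧ a ≤ n
    · rw [hc a ha.1 ha.2,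
        List.count_eq_one_of_mem List.nodup_range' (List.mem_range'_1.2 ⟨ha.1, by omega⟩)]
    · rw [List.count_eq_zero_of_not_mem, List.count_eq_zero_of_not_mem]
      · rw [List.mem_range'_1]; omega
      · rw [(faroShuffle_perm u v).mem_iff, List.mem_append]
        rintro (h | h)
        · exact ha (hu a h)
        · exact ha (hv a h)
  obtain ⟨P, hP, rfl, rfl⟩ := Faro.exists_path n u v hsu hsv hp
  refine ⟨P, hP, ?_, rfl⟩
  have := length_ups_sub P
  rw [IsClosed]; omega

/-- For a closed path the length fixes the sizes of both hands, so the even positions of the word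
recover the times of the up-steps, which determine the path. -/
theorem word_injOn : Set.InjOn word {P | IsClosed P} := by
  intro P hP Q hQ h
  have hl : P.length = Q.length := by rw [← length_word P, h, length_word]
  refine ups_injective hl (List.ext_getElem? fun j => ?_)
  have hU : (ups P).length = (ups Q).length := by
    have h1 := hP.length_le
    have h2 := hQ.length_le
    have h3 := length_ups_add P
    have h4 := length_ups_add Q
    omega
  have := (getD_word hP (2 * j)).symm.trans (by rw [h, getD_word hQ])
  simp only [letter, Nat.mul_mod_right, if_true, Nat.mul_div_cancel_left j two_pos] at this
  by_cases hj : j < (ups P).length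
  · rw [List.getD_eq_getElem _ _ hj, List.getD_eq_getElem _ _ (hU ▸ hj)] at this
    rw [List.getElem?_eq_getElem hj, List.getElem?_eq_getElem (hU ▸ hj), this]
  · rw [List.getElem?_eq_none (by omega), List.getElem?_eq_none (by omega)]

/-! ### Letters -/

theorem letter_cons (c : Bool) (P : List Bool) (i : ℕ) :
    letter (c :: P) i = if i = slot c P then P.length + 1 else letter P i := by
  have key : ∀ (l : List ℕ) (j m : ℕ), (l ++ [m]).getD j 0 = if j = l.length then m
      else l.getD j 0 := by
    intro l j m
    simp only [List.getD_eq_getElem?_getD, List.getElem?_append]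
    split_ifs with h1 h2 h2
    · omega
    · rfl
    · simp [h2]
    · rw [List.getElem?_eq_none (by simp; omega), List.getElem?_eq_none (by omega)]
  rcases Nat.mod_two_eq_zero_or_one i with hi | hi <;> cases c <;>
    simp only [letter, ups, downs, slot, hi, key, if_true, Bool.false_eq_true, if_false,
      one_ne_zero]
  · rw [if_neg (by omega)]
  · exact if_congr (by omega) rfl rfl
  · exact if_congr (by omega) rfl rfl
  · rw [if_neg (by omega)]

theorem letter_le (P : List Bool) (i : ℕ) : letter P i ≤ P.length := by
  induction P with
  | nil => simp [letter, ups, downs]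
  | cons c P ih => rw [letter_cons, List.length_cons]; split_ifs <;> omega

theorem letter_ne_zero_iff (P : List Bool) (i : ℕ) :
    letter P i ≠ 0 ↔ i / 2 < if i % 2 = 0 then (ups P).length else (downs P).length := by
  induction P with
  | nil => simp [letter, ups, downs]
  | cons c P ih =>
    rw [letter_cons]
    rcases Nat.mod_two_eq_zero_or_one i with hi | hi <;> cases c <;>
      simp only [hi, ups, downs, slot, if_true, Bool.false_eq_true, if_false, one_ne_zero,
        List.length_append, List.length_singleton] at ih ⊢ <;>
      split_ifs <;> omega

theorem letter_slot (c : Bool) (P : List Bool) : letter P (slot c P) = 0 := by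
  by_contra h
  have := (letter_ne_zero_iff P _).1 h
  cases c <;> simp [slot] at this <;> omega

theorem letter_eq_zero_of_le {P : List Bool} {i j : ℕ} (h : i % 2 = j % 2) (hij : i ≤ j)
    (hi : letter P i = 0) : letter P j = 0 := by
  by_contra hj
  have h1 := (letter_ne_zero_iff P j).1 hj
  have h2 := (not_congr (letter_ne_zero_iff P i)).1 (not_not.2 hi)
  rw [h] at h2
  split_ifs at h1 h2 <;> omega

theorem letter_lt_add_two {P : List Bool} {i : ℕ} (h : letter P (i + 2) ≠ 0) :
    letter P i < letter P (i + 2) := by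
  induction P with
  | nil => simp [letter, ups, downs] at h
  | cons c P ih =>
    rw [letter_cons, letter_cons] at *
    by_cases h1 : i + 2 = slot c P
    · rw [if_pos h1, if_neg (by omega)]
      have := letter_le P i; omega
    · rw [if_neg h1] at *
      rw [if_neg]
      · exact ih h
      · rintro rfl
        exact h (letter_eq_zero_of_le (by omega) (by omega) (letter_slot c P))

theorem letter_injective {P : List Bool} {i j : ℕ} (hi : letter P i ≠ 0)
    (h : letter P i = letter P j) : i = j := by
  induction P with
  | nil => simp [letter, ups, downs] at hi
  | cons c P ih =>
    rw [letter_cons] at hi h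
    rw [letter_cons] at h
    have h1 := letter_le P i
    have h2 := letter_le P j
    split_ifs at hi h with h3 h4 h4
    · omega
    · omega
    · omega
    · exact ih hi h

theorem letter_ne_zero {P : List Bool} (h : IsClosed P) {i : ℕ} (hi : i < P.length) :
    letter P i ≠ 0 := by
  rw [letter_ne_zero_iff]
  have h1 := h.length_le
  have h2 := length_ups_add P
  split_ifs <;> omega

/-- An up-step fills position 2|u|, whose successor is filled iff |u| < |v|, that is, at negative
height. A down-step fills position 2|v| + 1, whose successor is filled iff |v| + 1 < |u|, that is,
at height above 1. -/
theorem letter_succ_slot (c : Bool) (P : List Bool) :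
    (if letter P (slot c P + 1) ≠ 0 then 1 else 0) = stepCost 0 1 c (height P) := by
  have h := length_ups_sub P
  rw [stepCost, ← h]
  refine (if_congr (letter_ne_zero_iff _ _) rfl rfl).trans ?_
  have h0 : ∀ m, (2 * m + 1) % 2 = 1 := by omega
  have h0' : ∀ m, (2 * m + 1 + 1) % 2 = 0 := by omega
  cases c <;> simp only [slot, h0, h0', if_true, Bool.false_eq_true, if_false, one_ne_zero] <;>
    split_ifs <;> omega

/-- The first step of a path decides which of the first two positions holds the letter `1`. -/
theorem letter_getLast (P : List Bool) (hP : P ≠ []) :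
    if P.getLast hP then letter P 0 = 1 ∧ letter P 1 ≠ 1 else letter P 1 = 1 ∧ letter P 0 ≠ 1 := by
  induction P with
  | nil => exact absurd rfl hP
  | cons c P ih =>
    by_cases hP' : P = []
    · subst hP'
      cases c <;> simp [letter, ups, downs]
    · have hl := List.length_pos_iff.2 hP'
      rw [List.getLast_cons hP']
      have h0 := letter_slot c P
      specialize ih hP'
      simp only [letter_cons]
      split_ifs at ih ⊢ <;> simp_all <;> omega

/-! ### Descents -/

/-- The indicator of a descent at position `i`. -/
def desc (f : ℕ → ℕ) (i : ℕ) : ℕ := if f (i + 1) < f i then 1 else 0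

/-- Allowing vacant positions makes the induction run over all paths, closed or not; a descent into
a vacancy, coded by 0, is not counted. -/
theorem card_descents (P : List Bool) (N : ℕ) (hN : 2 * P.length ≤ N) :
    ((Finset.range N).filter fun i => letter P (i + 1) ≠ 0 ∧ letter P (i + 1) < letter P i).card
      = stat 0 0 0 1 P := by
  induction P with
  | nil => simp [letter, ups, downs, stat]
  | cons c P ih =>
    rw [List.length_cons] at hN
    have hstat : stat 0 0 0 1 (c :: P) = stat 0 0 0 1 P + stepCost 0 1 c (height P) := by
      by_cases hP : P = []
      · subst hP; cases c <;> rfl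
      · exact stat_cons _ _ _ _ _ hP
    rw [hstat, ← ih (by omega), ← letter_succ_slot]
    have h0 := letter_slot c P
    have hle := letter_le P
    have hs : slot c P < N := by
      have := length_ups_add P
      cases c <;> simp [slot] <;> omega
    -- The new letter exceeds all others, so no descent ends at it, and one starts at it iff its
    -- right neighbour is present.
    have e : ((Finset.range N).filter fun i =>
        letter (c :: P) (i + 1) ≠ 0 ∧ letter (c :: P) (i + 1) < letter (c :: P) i) =
        ((Finset.range N).filter fun i => letter P (i + 1) ≠ 0 ∧ letter P (i + 1) < letter P i)
          ∪ (if letter P (slot c P + 1) ≠ 0 then {slot c P} else ∅) := by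
      ext i
      simp only [Finset.mem_filter, Finset.mem_union, letter_cons, Finset.mem_range]
      have h1 := hle i
      have h2 := hle (i + 1)
      by_cases hi : i = slot c P
      · subst hi
        rw [if_neg (by omega), if_pos rfl]
        split_ifs with h3
        · simp [h3, hs]; omega
        · simp [h3]
      · rw [if_neg hi]
        by_cases hi' : i + 1 = slot c P
        · rw [if_pos hi', hi', h0]
          split_ifs <;> simp [hi] <;> omega
        · rw [if_neg hi']
          split_ifs <;> simp [hi]
    rw [e, Finset.card_union_of_disjoint]
    · split_ifs <;> simp
    · split_ifs <;> simp [h0]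

theorem sum_desc {P : List Bool} (h : IsClosed P) :
    ∑ i ∈ Finset.range (P.length - 1), desc (letter P) i = stat 0 0 0 1 P := by
  rw [← card_descents P (2 * P.length) le_rfl]
  simp only [desc, Finset.sum_boole, Nat.cast_id]
  congr 1
  ext i
  simp only [Finset.mem_filter, Finset.mem_range]
  constructor
  · rintro ⟨h1, h2⟩
    exact ⟨by omega, letter_ne_zero h (by omega), h2⟩
  · rintro ⟨h1, h2, h3⟩
    refine ⟨?_, h3⟩
    rw [letter_ne_zero_iff] at h2
    have h4 := h.length_le
    have h5 := length_ups_add P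
    split_ifs at h2 <;> omega

theorem desc_zero {P : List Bool} (h : IsClosed P) (hP : 2 ≤ P.length) :
    desc (letter P) 0 = if P.getLast (List.length_pos_iff.1 (by omega)) then 0 else 1 := by
  have h0 := letter_ne_zero h (i := 0) (by omega)
  have h1 := letter_ne_zero h (i := 1) (by omega)
  have := letter_getLast P (List.length_pos_iff.1 (by omega))
  rw [desc]
  split_ifs at this ⊢ <;> simp at * <;> omega

/-- In a closed path the largest letter occupies one of the last two positions; the last pair
descends iff it is the penultimate one. -/
theorem desc_last {c : Bool} {P : List Bool} (h : IsClosed (c :: P)) (hP : P ≠ []) :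
    desc (letter (c :: P)) (P.length - 1) = stepCost 0 1 c (height P) := by
  have h0 := List.length_pos_iff.2 hP
  have h1 := length_ups_sub P
  have h2 := length_ups_add P
  have h3 := letter_le P
  rw [desc, Nat.sub_add_cancel h0, letter_cons, letter_cons, stepCost]
  have h4 := h3 (P.length - 1)
  have h5 := h3 P.length
  rw [IsClosed] at h
  cases c <;> simp only [slot, if_true, Bool.false_eq_true, if_false, height] at h ⊢ <;>
    split_ifs <;> omega

/-! ### Occurrences of patterns -/

theorem occ_eq (p w : List ℕ) : occ p w = ((Finset.range (w.length + 1 - p.length)).filter fun i =>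
    ∀ j < p.length, ∀ k < p.length,
      (w.getD (i + j) 0 < w.getD (i + k) 0 ↔ p.getD j 0 < p.getD k 0)).card := by
  rw [occ]
  congr 1
  refine Finset.filter_congr fun i hi => ?_
  rw [Finset.mem_range] at hi
  have hl : ((w.drop i).take p.length).length = p.length := by simp; omega
  have hg : ∀ j < p.length, ((w.drop i).take p.length).getD j 0 = w.getD (i + j) 0 := by
    intro j hj
    simp [List.getD_eq_getElem?_getD, hj]
  rw [OrderIsomorphic, hl]
  simp only [true_and]
  refine forall₂_congr fun j hj => forall₂_congr fun k hk => ?_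
  rw [hg j hj, hg k hk]

section occurrences

variable {P : List Bool}

theorem occ_word (h : IsClosed P) (p : List ℕ) (g : ℕ → ℕ)
    (hg : ∀ i < P.length + 1 - p.length, (if ∀ j < p.length, ∀ k < p.length,
      (letter P (i + j) < letter P (i + k) ↔ p.getD j 0 < p.getD k 0) then 1 else 0) = g i) :
    occ p (word P) = ∑ i ∈ Finset.range (P.length + 1 - p.length), g i := by
  rw [occ_eq, length_word, Finset.card_filter]
  refine Finset.sum_congr rfl fun i hi => ?_
  rw [← hg i (Finset.mem_range.1 hi)]
  simp only [getD_word h]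

theorem letter_lt_of_closed (h : IsClosed P) {i : ℕ} (hi : i + 2 < P.length) :
    letter P i < letter P (i + 2) := letter_lt_add_two (letter_ne_zero h hi)

theorem letter_ne_succ (h : IsClosed P) {i : ℕ} (hi : i + 1 < P.length) :
    letter P i ≠ letter P (i + 1) := fun e =>
  absurd (letter_injective (letter_ne_zero h (by omega)) e) (by omega)

theorem occ_word_descent (h : IsClosed P) :
    occ [2, 1] (word P) = ∑ i ∈ Finset.range (P.length - 1), desc (letter P) i := by
  refine occ_word h _ _ fun i hi => ?_
  simp only [List.length_cons, List.length_nil] at hi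
  simp only [List.length_cons, List.length_nil, Nat.forall_lt_succ_left, desc]
  refine if_congr ?_ rfl rfl
  simp; omega

theorem occ_word_ascent (h : IsClosed P) :
    occ [1, 2] (word P) = ∑ i ∈ Finset.range (P.length - 1), (1 - desc (letter P) i) := by
  refine occ_word h _ _ fun i hi => ?_
  simp only [List.length_cons, List.length_nil] at hi
  have := letter_ne_succ h (i := i) (by omega)
  simp only [List.length_cons, List.length_nil, Nat.forall_lt_succ_left, desc]
  simp
  split_ifs <;> omega

/-- As w_i < w_{i+2}, a descent from w_{i+1} to w_{i+2} already forces the pattern 132. -/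
theorem occ_word_peak (h : IsClosed P) :
    occ [1, 3, 2] (word P) = ∑ i ∈ Finset.range (P.length - 2), desc (letter P) (i + 1) := by
  refine occ_word h _ _ fun i hi => ?_
  simp only [List.length_cons, List.length_nil] at hi
  have := letter_lt_of_closed h (i := i) (by omega)
  simp only [List.length_cons, List.length_nil, Nat.forall_lt_succ_left, desc]
  refine if_congr ?_ rfl rfl
  simp [add_assoc]; omega

theorem occ_word_valley (h : IsClosed P) :
    occ [2, 1, 3] (word P) = ∑ i ∈ Finset.range (P.length - 2), desc (letter P) i := by
  refine occ_word h _ _ fun i hi => ?_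
  simp only [List.length_cons, List.length_nil] at hi
  have := letter_lt_of_closed h (i := i) (by omega)
  simp only [List.length_cons, List.length_nil, Nat.forall_lt_succ_left, desc]
  refine if_congr ?_ rfl rfl
  simp [add_assoc]; omega

/-- Two consecutive descents would contradict w_i < w_{i+2}, so the truncated subtraction loses
nothing. -/
theorem occ_word_run (h : IsClosed P) :
    occ [1, 2, 3] (word P) = ∑ i ∈ Finset.range (P.length - 2),
      (1 - desc (letter P) i - desc (letter P) (i + 1)) := by
  refine occ_word h _ _ fun i hi => ?_
  simp only [List.length_cons, List.length_nil] at hi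
  have := letter_lt_of_closed h (i := i) (by omega)
  have := letter_ne_succ h (i := i) (by omega)
  have := letter_ne_succ h (i := i + 1) (by omega)
  simp only [List.length_cons, List.length_nil, Nat.forall_lt_succ_left, desc]
  simp [add_assoc] at *
  split_ifs <;> omega

end occurrences


/-! ### Occurrences of patterns and weights of paths -/

/-- Every step lies between heights 0 and 1, approaches them, or moves away. Departures exceed
approaches by the final distance to {0, 1}, which is the last term. A first up-step lies between 0
and 1, a first down-step moves away: hence p = 1 and q = 0. -/
theorem length_eq_stat (P : List Bool) : (P.length : ℤ) =
    stat 1 0 1 0 P + 2 * stat 0 0 0 1 P + (if 1 ≤ height P then height P - 1 else - height P) := by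
  induction P with
  | nil => simp [stat, height]
  | cons c P ih =>
    by_cases hP : P = []
    · subst hP; cases c <;> simp [stat, height]
    · rw [stat_cons _ _ _ _ _ hP, stat_cons _ _ _ _ _ hP, List.length_cons]
      push_cast
      rw [ih]
      cases c <;> simp only [stepCost, height, if_true, Bool.false_eq_true, if_false] <;>
        split_ifs <;> push_cast <;> omega

theorem length_eq_of_closed {P : List Bool} (h : IsClosed P) :
    P.length = stat 1 0 1 0 P + 2 * stat 0 0 0 1 P := by
  have := length_eq_stat P
  rcases h with h | h <;> rw [h] at this <;> norm_num at this <;> exact_mod_cast this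

theorem stat_add (p q a b p' q' a' b' : ℕ) (P : List Bool) :
    stat (p + p') (q + q') (a + a') (b + b') P = stat p q a b P + stat p' q' a' b' P := by
  induction P with
  | nil => rfl
  | cons c P ih =>
    by_cases hP : P = []
    · subst hP; cases c <;> simp [stat]
    · rw [stat_cons _ _ _ _ _ hP, stat_cons _ _ _ _ _ hP, stat_cons _ _ _ _ _ hP, ih]
      simp only [stepCost]
      split_ifs <;> omega

theorem stat_first_step (p q : ℕ) (P : List Bool) (hP : P ≠ []) :
    stat p q 0 0 P = if P.getLast hP then p else q := by
  induction P with
  | nil => exact absurd rfl hP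
  | cons c P ih =>
    by_cases hP' : P = []
    · subst hP'; cases c <;> rfl
    · rw [stat_cons _ _ _ _ _ hP', ih hP', List.getLast_cons hP']
      simp [stepCost]

theorem occ_descent_eq_stat {P : List Bool} (h : IsClosed P) :
    occ [2, 1] (word P) = stat 0 0 0 1 P := by
  rw [occ_word_descent h, sum_desc h]

theorem desc_le_one (f : ℕ → ℕ) (i : ℕ) : desc f i ≤ 1 := by
  rw [desc]; split_ifs <;> omega

theorem occ_ascent_eq_stat {P : List Bool} (h : IsClosed P) (hP : P ≠ []) :
    occ [1, 2] (word P) + 1 = stat 1 0 1 1 P := by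
  have h1 := length_eq_of_closed h
  have h2 : stat 1 0 1 1 P = stat 1 0 1 0 P + stat 0 0 0 1 P := stat_add 1 0 1 0 0 0 0 1 P
  have h3 : occ [1, 2] (word P) + stat 0 0 0 1 P = P.length - 1 := by
    rw [occ_word_ascent h, ← sum_desc h, ← Finset.sum_add_distrib]
    simp [Nat.sub_add_cancel (desc_le_one _ _)]
  have := List.length_pos_iff.2 hP
  omega

theorem occ_peak_add {P : List Bool} (h : IsClosed P) (hP : 2 ≤ P.length) :
    occ [1, 3, 2] (word P) + desc (letter P) 0 = stat 0 0 0 1 P := by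
  obtain ⟨m, hm⟩ := Nat.exists_eq_add_of_le' hP
  rw [occ_word_peak h, ← sum_desc h, show P.length - 1 = P.length - 2 + 1 by omega,
    Finset.sum_range_succ']

theorem occ_valley_add {P : List Bool} (h : IsClosed P) (hP : 2 ≤ P.length) :
    occ [2, 1, 3] (word P) + desc (letter P) (P.length - 2) = stat 0 0 0 1 P := by
  rw [occ_word_valley h, ← sum_desc h, show P.length - 1 = P.length - 2 + 1 by omega,
    Finset.sum_range_succ]

theorem occ_run_add {P : List Bool} (h : IsClosed P) :
    occ [1, 2, 3] (word P) + occ [2, 1, 3] (word P) + occ [1, 3, 2] (word P) = P.length - 2 := by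
  rw [occ_word_run h, occ_word_valley h, occ_word_peak h, ← Finset.sum_add_distrib,
    ← Finset.sum_add_distrib, Finset.sum_congr rfl (g := fun _ => 1)]
  · simp
  · intro i hi
    rw [Finset.mem_range] at hi
    have := letter_lt_of_closed h (i := i) (by omega)
    simp only [desc, add_assoc, Nat.reduceAdd]
    split_ifs <;> omega

/-- The descent at position 0 is the only one that is not a 132, and it exists iff the first step
goes down. The shift by 1 avoids subtraction: the first step then contributes 1 when it goes up. -/
theorem occ_peak_eq_stat {P : List Bool} (h : IsClosed P) (hP : P ≠ []) :
    occ [1, 3, 2] (word P) + 1 = stat 1 0 0 1 P := by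
  have h1 := stat_first_step 1 0 P hP
  have h2 : stat 1 0 0 1 P = stat 1 0 0 0 P + stat 0 0 0 1 P := stat_add 1 0 0 0 0 0 0 1 P
  rw [h2, h1]
  rcases P with _ | ⟨c, _ | ⟨c', P⟩⟩
  · exact absurd rfl hP
  · cases c
    · simp [IsClosed, height] at h
    · simp [occ_word_peak h, stat]
  · have h3 := occ_peak_add h (by simp)
    rw [desc_zero h (by simp)] at h3
    split_ifs at h3 ⊢ <;> omega

theorem occ_valley_eq_stat {c : Bool} {P : List Bool} (h : IsClosed (c :: P)) (hP : P ≠ []) :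
    occ [2, 1, 3] (word (c :: P)) = stat 0 0 0 1 P := by
  have hl := List.length_pos_iff.2 hP
  have h1 := occ_valley_add h (by rw [List.length_cons]; omega)
  rw [stat_cons _ _ _ _ _ hP, show (c :: P).length - 2 = P.length - 1 by simp,
    desc_last h hP] at h1
  omega

/-- Subtracting the counts of 132 and 213 from the n - 2 windows cancels all approaching steps; what
is left is the steps between 0 and 1 other than the first and the last of the whole path. -/
theorem occ_run_eq_stat {c : Bool} {P : List Bool} (h : IsClosed (c :: P)) (hP : P ≠ []) :
    occ [1, 2, 3] (word (c :: P)) = stat 0 0 1 0 P := by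
  have hl := List.length_pos_iff.2 hP
  have h2l : 2 ≤ (c :: P).length := by rw [List.length_cons]; omega
  have h1 := occ_run_add h
  have h2 := occ_valley_eq_stat h hP
  have h3 := occ_peak_add h h2l
  have h4 := length_eq_of_closed h
  have h5 := stat_first_step 1 0 P hP
  have h6 : stat 1 0 1 0 P = stat 1 0 0 0 P + stat 0 0 1 0 P := stat_add 1 0 0 0 0 0 1 0 P
  have h7 : stepCost 1 0 c (height P) + stepCost 0 1 c (height P) = 1 := by
    rw [IsClosed] at h
    cases c <;> simp only [stepCost, height, if_true, Bool.false_eq_true, if_false] at h ⊢ <;>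
      split_ifs <;> omega
  rw [desc_zero h h2l, List.getLast_cons hP] at h3
  rw [stat_cons _ _ _ _ _ hP] at h3
  rw [stat_cons _ _ _ _ _ hP, stat_cons _ _ _ _ _ hP] at h4
  split_ifs at h3 h5 <;> omega

/-! ### The generating functions of faro permutations -/

/-- The exponents of `x` and `y` attached to a word. -/
noncomputable def wordWeight (p w : List ℕ) : Fin 2 →₀ ℕ := expo w.length (occ p w)

theorem K_eq_gf (p : List ℕ) :
    K p = gf (fun P => expo P.length (occ p (word P))) {P | IsClosed P} := by
  have e : K p = gf (wordWeight p) (word '' {P | IsClosed P}) := by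
    ext m
    rw [coeff_gf]
    refine congrArg (fun S : Set (List ℕ) => (S.ncard : ℚ)) (Set.ext fun w => ?_)
    constructor
    · rintro ⟨h, hk⟩
      obtain ⟨P, -, hP, rfl⟩ := h.exists_path
      exact ⟨⟨P, hP, rfl⟩, expo_eq_iff.2 ⟨h.2.1, hk⟩⟩
    · rintro ⟨⟨P, hP, rfl⟩, h⟩
      obtain ⟨h1, h2⟩ := expo_eq_iff.1 h
      refine ⟨?_, h2⟩
      rw [← h1, length_word]
      exact isFaroPerm_word hP
  rw [e, gf_image (s := fun P => expo P.length (occ p (word P))) word_injOn 0]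
  · simp
  · intro P _
    rw [wordWeight, length_word, zero_add]

theorem K_eq_one_add (p : List ℕ) (hp : p.length ≠ 0) :
    K p = 1 + gf (fun P => expo P.length (occ p (word P))) {P | P ≠ [] ∧ IsClosed P} := by
  have e : {P | IsClosed P} = {[]} ∪ {P | P ≠ [] ∧ IsClosed P} := by
    ext P
    by_cases hP : P = []
    · subst hP; simp [IsClosed, height]
    · simp [hP]
  have h0 : occ p (word []) = 0 := by
    rw [occ_eq, length_word, List.length_nil, show 0 + 1 - p.length = 0 by omega]; simp
  rw [K_eq_gf, e, gf_union, gf_singleton, h0, monomial_expo]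
  · simp
  · exact fun m => (List.finite_length_eq Bool (m 0)).subset fun P hP => (expo_eq_iff.1 hP).1
  · rw [Set.disjoint_left]
    rintro P rfl ⟨h, -⟩
    exact h rfl

theorem gf_or_height (p q a b : ℕ) {r : List Bool → Prop} {h : ℤ}
    (hr : ∀ P, r P → height P ≠ h) :
    gf (pathWeight p q a b) {P | P ≠ [] ∧ (r P ∨ height P = h)} =
      gf (pathWeight p q a b) {P | P ≠ [] ∧ r P} + pathGF p q a b h := by
  rw [pathGF, ← gf_union (pathWeight_finite p q a b)]
  · congr 1
    ext P
    simp only [Set.mem_union, Set.mem_ofPred_eq]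
    tauto
  · rw [Set.disjoint_left]
    rintro P ⟨-, h1⟩ ⟨-, h2⟩
    exact hr P h1 h2

theorem gf_closed (p q a b : ℕ) :
    gf (pathWeight p q a b) {P | P ≠ [] ∧ IsClosed P} = pathGF p q a b 0 + pathGF p q a b 1 :=
  gf_or_height p q a b fun P h => by omega

theorem K_descent : K [2, 1] = 1 + (pathGF 0 0 0 1 0 + pathGF 0 0 0 1 1) := by
  rw [K_eq_one_add _ (by simp), ← gf_closed]
  congr 1
  exact gf_congr fun P hP => by rw [pathWeight, occ_descent_eq_stat hP.2]

theorem y_mul_K {p : List ℕ} (hp : p.length ≠ 0) {p' q a b : ℕ}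
    (h : ∀ P, P ≠ [] → IsClosed P → occ p (word P) + 1 = stat p' q a b P) :
    y * K p = y + (pathGF p' q a b 0 + pathGF p' q a b 1) := by
  have hy : y = MvPowerSeries.monomial (expo 0 1) 1 := by rw [monomial_expo]; ring
  have := gf_image (f := id) (T := {P | P ≠ [] ∧ IsClosed P})
    (s := fun P => expo P.length (occ p (word P))) (t := pathWeight p' q a b)
    Function.injective_id.injOn (expo 0 1) fun P hP => by
      rw [id, expo_add, pathWeight, ← h P hP.1 hP.2, zero_add, add_comm 1]
  rw [← hy, Set.image_id, gf_closed] at this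
  rw [K_eq_one_add p hp, this]
  ring

/-- The case of a weight that ignores the last step. -/
theorem K_eq_of_tail {p : List ℕ} (hp : 1 < p.length) {p' q a b : ℕ}
    (h : ∀ c P, P ≠ [] → IsClosed (c :: P) → occ p (word (c :: P)) = stat p' q a b P) :
    K p = 1 + x + x * (pathGF p' q a b (-1) + pathGF p' q a b 0 + pathGF p' q a b 1
      + pathGF p' q a b 2) := by
  -- The last step of a closed path is forced by what precedes it: from heights -1 and 0 it goes up,
  -- from 1 and 2 down.
  let close : List Bool → List Bool := fun P => (decide (height P ≤ 0)) :: P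
  let T : Set (List Bool) :=
    {P | P ≠ [] ∧ (((height P = -1 ∨ height P = 0) ∨ height P = 1) ∨ height P = 2)}
  have hT : ∀ P ∈ T, IsClosed (close P) := by
    rintro P ⟨-, hP⟩
    by_cases h0 : height P ≤ 0 <;> simp only [IsClosed, close, h0, height, decide_true,
      decide_false] <;> omega
  have e : {P | P ≠ [] ∧ IsClosed P} = {[true]} ∪ close '' T := by
    ext P
    simp only [Set.mem_union, Set.mem_singleton_iff, Set.mem_image, Set.mem_ofPred_eq]
    constructor
    · rintro ⟨h1, h2⟩
      rcases P with _ | ⟨c, P⟩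
      · exact absurd rfl h1
      by_cases hP : P = []
      · subst hP; cases c
        · simp [IsClosed, height] at h2
        · exact Or.inl rfl
      · refine Or.inr ⟨P, ⟨hP, ?_⟩, ?_⟩ <;> cases c <;> simp only [IsClosed, height] at h2
        · omega
        · omega
        · simp only [close]; congr 1; simp; omega
        · simp only [close]; congr 1; simp; omega
    · rintro (rfl | ⟨Q, hQ, rfl⟩)
      · simp [IsClosed, height]
      · exact ⟨by simp [close], hT Q hQ⟩
  have h0 : occ p (word [true]) = 0 := by
    rw [occ_eq, length_word, List.length_singleton, show 1 + 1 - p.length = 0 by omega]; simp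
  rw [K_eq_one_add p (by omega), e, gf_union, gf_singleton,
    gf_image (s := pathWeight p' q a b) (d := expo 1 0), h0, monomial_expo, monomial_expo,
    gf_or_height, gf_or_height, gf_or_height]
  · simp [pathGF, add_assoc]
  · intro P h; omega
  · intro P h; omega
  · intro P h; omega
  · exact fun P _ Q _ h => (List.cons.inj h).2
  · intro P hP
    rw [h _ P hP.1 (hT P hP), pathWeight, expo_add, List.length_cons, zero_add, add_comm 1]
  · exact fun m => (List.finite_length_eq Bool (m 0)).subset fun P hP => (expo_eq_iff.1 hP).1
  · rw [Set.disjoint_left]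
    rintro P rfl ⟨Q, hQ, h⟩
    exact hQ.1 (List.cons.inj h).2

theorem K_ascent : y * K [1, 2] = y + (pathGF 1 0 1 1 0 + pathGF 1 0 1 1 1) :=
  y_mul_K (by simp) fun _ h1 h2 => occ_ascent_eq_stat h2 h1

theorem K_peak : y * K [1, 3, 2] = y + (pathGF 1 0 0 1 0 + pathGF 1 0 0 1 1) :=
  y_mul_K (by simp) fun _ h1 h2 => occ_peak_eq_stat h2 h1

theorem K_valley : K [2, 1, 3] = 1 + x + x * (pathGF 0 0 0 1 (-1) + pathGF 0 0 0 1 0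
    + pathGF 0 0 0 1 1 + pathGF 0 0 0 1 2) :=
  K_eq_of_tail (by simp) fun _ _ h1 h2 => occ_valley_eq_stat h2 h1

theorem K_run : K [1, 2, 3] = 1 + x + x * (pathGF 0 0 1 0 (-1) + pathGF 0 0 1 0 0
    + pathGF 0 0 1 0 1 + pathGF 0 0 1 0 2) :=
  K_eq_of_tail (by simp) fun _ _ h1 h2 => occ_run_eq_stat h2 h1

/-! ### Closed forms -/

theorem toFrac_eq_div {k n d : Series} (hd : d ≠ 0) (h : k * d = n) :
    toFrac k = toFrac n / toFrac d := by
  have : toFrac d ≠ 0 := by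
    rw [toFrac, Ne, FaithfulSMul.algebraMap_eq_zero_iff]; exact hd
  rw [eq_div_iff this, ← map_mul, h]

/-- E = (1 + √(1 - 4f))/2 is the root with constant term 1 of E² = E - f; it makes all later
identities polynomial. -/
theorem exists_half_add_sqrt {f : Series} (hf : MvPowerSeries.constantCoeff f = 0) :
    ∃ E : Series, sqrt (1 - 4 * f) = 2 * E - 1 ∧ MvPowerSeries.constantCoeff E = 1 ∧
      E ^ 2 = E - f := by
  have h1 : MvPowerSeries.constantCoeff (1 - 4 * f) = 1 := by simp [hf]
  have hs := sqrt_sq h1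
  have hc := constantCoeff_sqrt h1
  set s := sqrt (1 - 4 * f)
  have h2 : (2 : Series) * MvPowerSeries.C (1 / 2 : ℚ) = 1 := by
    rw [show (2 : Series) = MvPowerSeries.C 2 from (map_ofNat _ 2).symm, ← map_mul]; norm_num
  have h2' : (2 : Series) ≠ 0 := left_ne_zero_of_mul_eq_one h2
  set c : Series := MvPowerSeries.C (1 / 2 : ℚ) with hcdef
  have hE : 2 * (c * (1 + s)) = 1 + s := by linear_combination (1 + s) * h2
  refine ⟨c * (1 + s), by rw [hE]; ring, ?_, ?_⟩
  · rw [map_mul, map_add, hc, map_one, hcdef, MvPowerSeries.constantCoeff_C]; norm_num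
  · apply mul_left_cancel₀ h2'
    apply mul_left_cancel₀ h2'
    linear_combination (2 * (c * (1 + s)) + s - 1) * hE + hs

theorem denominator_ne_zero {E f : Series} (hE : MvPowerSeries.constantCoeff E = 1)
    (hf : MvPowerSeries.constantCoeff f = 0) : 1 - 2 * f + (2 * E - 1) ≠ 0 :=
  ne_zero_of_constantCoeff (by simp [hE, hf, map_ofNat])

end Faro

/-! ### The five closed forms -/

open Faro
theorem theorem9 :
    toFrac (K [2, 1]) = toFrac 2 / toFrac (1 - 2 * x + sqrt (1 - 4 * x ^ 2 * y)) ∧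
    toFrac (K [1, 2]) =
      toFrac (1 + y + 2 * x * y - 2 * x * y ^ 2 + (y - 1) * sqrt (1 - 4 * x ^ 2 * y)) /
        toFrac (y * (1 - 2 * x * y + sqrt (1 - 4 * x ^ 2 * y))) ∧
    toFrac (K [1, 3, 2]) =
      toFrac (1 + y + (y - 1) * sqrt (1 - 4 * x ^ 2 * y)) /
        toFrac (y * (1 - 2 * x + sqrt (1 - 4 * x ^ 2 * y))) ∧
    K [2, 1, 3] = K [1, 3, 2] ∧
    toFrac (K [1, 2, 3]) =
      toFrac (2 + 3 * x - 3 * x * y + 2 * x ^ 2 - 2 * x ^ 2 * y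
          - x * (1 - y) * sqrt (1 - 4 * x ^ 2)) /
        toFrac (1 - 2 * x * y + sqrt (1 - 4 * x ^ 2)) := by
  have hx := constantCoeff_x
  have hxy : MvPowerSeries.constantCoeff (x * y) = 0 := by simp [hx]
  obtain ⟨E, hs, hc, hE⟩ := exists_half_add_sqrt (f := x ^ 2 * y) (by simp [hx])
  obtain ⟨F, ht, hd, hF⟩ := exists_half_add_sqrt (f := x ^ 2) (by simp [hx])
  rw [← mul_assoc] at hs
  have hc0 : MvPowerSeries.constantCoeff E ≠ 0 := by rw [hc]; exact one_ne_zero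
  have hd0 : MvPowerSeries.constantCoeff F ≠ 0 := by rw [hd]; exact one_ne_zero
  have hE1 : E ^ 2 = E - x ^ 2 * y ^ 1 := by rw [hE, pow_one]
  have hF0 : F ^ 2 = F - x ^ 2 * y ^ 0 := by rw [hF, pow_zero, mul_one]
  have hne1 : 1 - 2 * x + (2 * E - 1) ≠ 0 := denominator_ne_zero hc hx
  have hne2 : 1 - 2 * x * y + (2 * E - 1) ≠ 0 := by
    rw [mul_assoc]; exact denominator_ne_zero hc hxy
  have hne3 : 1 - 2 * x * y + (2 * F - 1) ≠ 0 := by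
    rw [mul_assoc]; exact denominator_ne_zero hd hxy
  -- The denominator 1 - 2x + √(1 - 4x²y) is 2(E - x), twice the coefficient in `closedGF` at a = 0;
  -- at a = 1 the coefficient E - xy gives the other denominators in the same way.
  have peak : K [1, 3, 2] * (y * (1 - 2 * x + (2 * E - 1))) = 1 + y + (y - 1) * (2 * E - 1) := by
    have := closedGF (p := 1) (q := 0) (a := 0) hc0 hE1
    linear_combination (1 - 2 * x + (2 * E - 1)) * K_peak + 2 * this
  rw [hs, ht]
  refine ⟨?_, ?_, toFrac_eq_div (mul_ne_zero y_ne_zero hne1) peak, ?_, ?_⟩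
  · have := closedGF (p := 0) (q := 0) (a := 0) hc0 hE1
    refine toFrac_eq_div hne1 ?_
    rw [K_descent]
    linear_combination 2 * this
  · have := closedGF (p := 1) (q := 0) (a := 1) hc0 hE1
    refine toFrac_eq_div (mul_ne_zero y_ne_zero hne2) ?_
    linear_combination (1 - 2 * x * y + (2 * E - 1)) * K_ascent + 2 * this
  · have h1 := closedGF (p := 0) (q := 0) (a := 0) hc0 hE1
    have h2 := nearlyClosedGF (p := 0) (q := 0) (a := 0) hc0 hE1
    -- The equality with the series of 132 is checked after multiplication by its denominator, and
    -- by E to clear `nearlyClosedGF`.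
    apply mul_right_cancel₀ (mul_ne_zero y_ne_zero hne1)
    rw [peak, K_valley]
    apply mul_left_cancel₀ (ne_zero_of_constantCoeff hc0)
    linear_combination 2 * y * (E - x) * x * h2 + 2 * y * x * (E + x) * h1 + 2 * hE
  · have h1 := closedGF (p := 0) (q := 0) (a := 1) hd0 hF0
    have h2 := nearlyClosedGF (p := 0) (q := 0) (a := 1) hd0 hF0
    refine toFrac_eq_div hne3 ?_
    rw [K_run]
    apply mul_left_cancel₀ (ne_zero_of_constantCoeff hd0)
    linear_combination 2 * (F - x * y) * x * h2 + 2 * x * (F + x) * h1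
      + 2 * (1 + x - x * y) * hF
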